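/- Let $I_1, I_2, I_3\subseteq\mathbb R$ be nonempty open intervals (possibly unbounded), $I=I_1\times I_2\times I_3$, and let $f_2:I_1\to\mathbb R\setminus\{0\}$ and $f_3:I_1\times I_2\to\mathbb R\setminus\{0\}$ be smooth functions. Consider on $I$, with coordinates $(x^1,x^2,x^3)$, the Riemannian metric $$g=(dx^1)^2+\frac{1}{f_2(x^1)^2}(dx^2)^2+\frac{1}{f_3(x^1,x^2)^2}(dx^3)^2,$$ so that $(I,g)$ is the sequential warped product manifold $\left(I_1\times_{1/f_2}I_2\right)\times_{1/f_3}I_3$. Then $(I,g)$ is flat (that is, its Riemann curvature tensor vanishes identically) if and only if one of the following assertions holds, the formulas being understood for all $x^1\in I_1$, $x^2\in I_2$: (1) $f_2=k_2$ and $f_3=k_3$ for some $k_2,k_3\in\mathbb R\setminus\{0\}$; (2) $f_2=k_2$ and $f_3(x^1,x^2)=\dfrac{k_3}{x^1-c_3}$ for some $k_2,k_3\in\mathbb R\setminus\{0\}$, $c_3\in\mathbb R\setminus I_1$; (3) $f_2=k_2$ and $f_3(x^1,x^2)=\dfrac{k_3}{x^2-c_3}$ for some $k_2,k_3\in\mathbb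 R\setminus\{0\}$, $c_3\in\mathbb R\setminus I_2$; (4) $f_2=k_2$ and $f_3(x^1,x^2)=\dfrac{k_3}{c_1x^1+x^2+c_2}$ for some $k_2,k_3,c_1\in\mathbb R\setminus\{0\}$, $c_2\in\mathbb R$ such that $c_1x^1+x^2+c_2\neq0$ for all $(x^1,x^2)\in I_1\times I_2$; (5) $f_2(x^1)=\dfrac{k_2}{x^1-c_2}$ and $f_3=k_3$ for some $k_2,k_3\in\mathbb R\setminus\{0\}$, $c_2\in\mathbb R\setminus I_1$; (6) $f_2(x^1)=\dfrac{k_2}{x^1-c_2}$ and $f_3(x^1,x^2)=\dfrac{k_3}{(x^1-c_2)\cos\left(\frac{x^2}{k_2}-c_3\right)}$ for some $k_2,k_3\in\mathbb R\setminus\{0\}$, $c_2\in\mathbb R\setminus I_1$, $c_3\in\mathbb R$ such that $\left|\frac{x^2}{k_2}-c_3\right|<\frac{\pi}{2}$ for all $x^2\in I_2$; (7) $f_2(x^1)=\dfrac{k_2}{x^1-c_2}$ and $f_3(x^1,x^2)=\dfrac{k_3}{1+c_1(x^1-c_2)\cos\left(\frac{x^2}{k_2}-c_3\right)}$ for some $c_1,k_2,k_3\in\mathbb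 R\setminus\{0\}$, $c_2\in\mathbb R\setminus I_1$, $c_3\in\mathbb R$ such that $1+c_1(x^1-c_2)\cos\left(\frac{x^2}{k_2}-c_3\right)\neq0$ for all $(x^1,x^2)\in I_1\times I_2$. Moreover, in case (1), $(I,g)$ is a direct product of Riemannian manifolds $(I_i,g_i)$, $i\in\{1,2,3\}$; and in each of the cases (2)–(5), $(I,g)$ is a warped product: for some partition of the three factors of $I$ into two nonempty groups, with products $M_1$ and $M_2$, there are Riemannian metrics $g_{M_1}$, $g_{M_2}$ and a smooth function $\varphi:M_1\to\mathbb R\setminus\{0\}$ such that $g=\pi_1^*g_{M_1}+(\varphi\circ\pi_1)^2\,\pi_2^*g_{M_2}$, where $\pi_1,\pi_2$ are the projections of $I$ onto $M_1$ and $M_2$. -/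

import Mathlib

open scoped ContDiff

/-! Riemannian metrics in global coordinates on subsets of `ι → ℝ`: a metric is given by the field
of its coefficient matrices `x ↦ (g_{ij}(x))`. -/

/-- The metric with coefficients `g` is a smooth Riemannian metric on the set `U`. -/
def IsRiemannianMetricOn {ι : Type*} [Fintype ι] (U : Set (ι → ℝ))
    (g : (ι → ℝ) → Matrix ι ι ℝ) : Prop :=
  (∀ i j, ContDiffOn ℝ ∞ (fun x => g x i j) U) ∧ ∀ x ∈ U, (g x).PosDef

/-- The partial derivative `∂F/∂x^i` at `x`. -/
noncomputable def partialDeriv {ι : Type*} [Fintype ι] [DecidableEq ι] (i : ι)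
    (F : (ι → ℝ) → ℝ) (x : ι → ℝ) : ℝ :=
  fderiv ℝ F x (Pi.single i 1)

/-- The Christoffel symbol `Γ^k_{ij}` of the Levi-Civita connection of `g`, that is,
`∇_{∂_i} ∂_j = ∑ k, Γ^k_{ij} ∂_k`. -/
noncomputable def christoffel {ι : Type*} [Fintype ι] [DecidableEq ι]
    (g : (ι → ℝ) → Matrix ι ι ℝ) (k i j : ι) (x : ι → ℝ) : ℝ :=
  1 / 2 * ∑ l, (g x)⁻¹ k l *
    (partialDeriv i (fun y => g y j l) x + partialDeriv j (fun y => g y i l) x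
      - partialDeriv l (fun y => g y i j) x)

/-- The coefficient `R^l_{ijk}` of the Riemann curvature tensor
`R(X,Y)Z = ∇_X ∇_Y Z - ∇_Y ∇_X Z - ∇_{[X,Y]} Z` of `g`, that is,
`R(∂_i, ∂_j) ∂_k = ∑ l, R^l_{ijk} ∂_l`. -/
noncomputable def riemannCoeff {ι : Type*} [Fintype ι] [DecidableEq ι]
    (g : (ι → ℝ) → Matrix ι ι ℝ) (l i j k : ι) (x : ι → ℝ) : ℝ :=
  partialDeriv i (christoffel g l j k) x - partialDeriv j (christoffel g l i k) x
    + ∑ m, (christoffel g l i m x * christoffel g m j k x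
      - christoffel g l j m x * christoffel g m i k x)

/-- The metric `g` is flat on `U`: its Riemann curvature tensor vanishes there. -/
def IsFlatOn {ι : Type*} [Fintype ι] [DecidableEq ι] (U : Set (ι → ℝ))
    (g : (ι → ℝ) → Matrix ι ι ℝ) : Prop :=
  ∀ x ∈ U, ∀ l i j k, riemannCoeff g l i j k x = 0

/-! Product manifolds `∏ i, I i` of subsets of the line. -/

/-- The product of the sets `I i`, where `i` runs over the indices in `S`. -/
def boxOver {ι : Type*} (I : ι → Set ℝ) (S : Finset ι) : Set (S → ℝ) :=
  Set.univ.pi fun i => I i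

/-- The pull-back `π^* h` of a metric `h` by the projection `π : x ↦ (x^i)_{i ∈ S}`: its matrix
at `x` is `Pᵀ h(π x) P`, where `P` is the Jacobian matrix of `π`. -/
def projPullback {ι : Type*} [DecidableEq ι] (S : Finset ι)
    (h : (S → ℝ) → Matrix S S ℝ) (x : ι → ℝ) : Matrix ι ι ℝ :=
  let P : Matrix S ι ℝ := Matrix.of fun a i => if (a : ι) = i then 1 else 0
  P.transpose * h (S.restrict x) * P

/-- `(∏ i, I i, g)` is a direct product of Riemannian manifolds `(I i, h i)`. -/
def IsDirectProductOn {ι : Type*} [Fintype ι] [DecidableEq ι] (I : ι → Set ℝ)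
    (g : (ι → ℝ) → Matrix ι ι ℝ) : Prop :=
  ∃ h : (i : ι) → (({i} : Finset ι) → ℝ) → Matrix ({i} : Finset ι) ({i} : Finset ι) ℝ,
    (∀ i, IsRiemannianMetricOn (boxOver I {i}) (h i)) ∧
    ∀ x ∈ Set.univ.pi I, g x = ∑ i, projPullback {i} (h i) x

/-- `(∏ i, I i, g)` is a warped product `M₁ ×_φ M₂`, where `M₁` is the product of the factors
`I i` with `i ∈ S`, `M₂` is the product of the remaining ones, each carrying some Riemannian
metric, and `φ` is a smooth nowhere zero function on `M₁`. -/
def IsWarpedProductOn {ι : Type*} [Fintype ι] [DecidableEq ι] (I : ι → Set ℝ)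
    (g : (ι → ℝ) → Matrix ι ι ℝ) : Prop :=
  ∃ S : Finset ι, S.Nonempty ∧ Sᶜ.Nonempty ∧
  ∃ (g₁ : (S → ℝ) → Matrix S S ℝ)
    (g₂ : ((Sᶜ : Finset ι) → ℝ) → Matrix (Sᶜ : Finset ι) (Sᶜ : Finset ι) ℝ)
    (φ : (S → ℝ) → ℝ),
    IsRiemannianMetricOn (boxOver I S) g₁ ∧ IsRiemannianMetricOn (boxOver I Sᶜ) g₂ ∧
    ContDiffOn ℝ ∞ φ (boxOver I S) ∧ (∀ y ∈ boxOver I S, φ y ≠ 0) ∧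
    ∀ x ∈ Set.univ.pi I,
      g x = projPullback S g₁ x + (φ (S.restrict x)) ^ 2 • projPullback Sᶜ g₂ x

/-- The metric `(dx^1)² + φ(x^1)² (dx^2)² + ψ(x^1, x^2)² (dx^3)²` of the sequential warped
product `(I₁ ×_φ I₂) ×_ψ I₃` of three intervals. -/
def seqWarpedMetric (φ : ℝ → ℝ) (ψ : ℝ → ℝ → ℝ) (x : Fin 3 → ℝ) : Matrix (Fin 3) (Fin 3) ℝ :=
  Matrix.diagonal ![1, (φ (x 0)) ^ 2, (ψ (x 0) (x 1)) ^ 2]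

/-! The seven families of pairs `(f₂, f₃)`. -/

def Family1 (I₁ I₂ : Set ℝ) (f₂ : ℝ → ℝ) (f₃ : ℝ → ℝ → ℝ) : Prop :=
  ∃ k₂ k₃ : ℝ, k₂ ≠ 0 ∧ k₃ ≠ 0 ∧ (∀ s ∈ I₁, f₂ s = k₂) ∧ ∀ s ∈ I₁, ∀ t ∈ I₂, f₃ s t = k₃

def Family2 (I₁ I₂ : Set ℝ) (f₂ : ℝ → ℝ) (f₃ : ℝ → ℝ → ℝ) : Prop :=
  ∃ k₂ k₃ c₃ : ℝ, k₂ ≠ 0 ∧ k₃ ≠ 0 ∧ c₃ ∉ I₁ ∧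
    (∀ s ∈ I₁, f₂ s = k₂) ∧ ∀ s ∈ I₁, ∀ t ∈ I₂, f₃ s t = k₃ / (s - c₃)

def Family3 (I₁ I₂ : Set ℝ) (f₂ : ℝ → ℝ) (f₃ : ℝ → ℝ → ℝ) : Prop :=
  ∃ k₂ k₃ c₃ : ℝ, k₂ ≠ 0 ∧ k₃ ≠ 0 ∧ c₃ ∉ I₂ ∧
    (∀ s ∈ I₁, f₂ s = k₂) ∧ ∀ s ∈ I₁, ∀ t ∈ I₂, f₃ s t = k₃ / (t - c₃)

def Family4 (I₁ I₂ : Set ℝ) (f₂ : ℝ → ℝ) (f₃ : ℝ → ℝ → ℝ) : Prop :=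
  ∃ k₂ k₃ c₁ c₂ : ℝ, k₂ ≠ 0 ∧ k₃ ≠ 0 ∧ c₁ ≠ 0 ∧
    (∀ s ∈ I₁, ∀ t ∈ I₂, c₁ * s + t + c₂ ≠ 0) ∧
    (∀ s ∈ I₁, f₂ s = k₂) ∧ ∀ s ∈ I₁, ∀ t ∈ I₂, f₃ s t = k₃ / (c₁ * s + t + c₂)

def Family5 (I₁ I₂ : Set ℝ) (f₂ : ℝ → ℝ) (f₃ : ℝ → ℝ → ℝ) : Prop :=
  ∃ k₂ k₃ c₂ : ℝ, k₂ ≠ 0 ∧ k₃ ≠ 0 ∧ c₂ ∉ I₁ ∧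
    (∀ s ∈ I₁, f₂ s = k₂ / (s - c₂)) ∧ ∀ s ∈ I₁, ∀ t ∈ I₂, f₃ s t = k₃

def Family6 (I₁ I₂ : Set ℝ) (f₂ : ℝ → ℝ) (f₃ : ℝ → ℝ → ℝ) : Prop :=
  ∃ k₂ k₃ c₂ c₃ : ℝ, k₂ ≠ 0 ∧ k₃ ≠ 0 ∧ c₂ ∉ I₁ ∧ (∀ t ∈ I₂, |t / k₂ - c₃| < Real.pi / 2) ∧
    (∀ s ∈ I₁, f₂ s = k₂ / (s - c₂)) ∧
    ∀ s ∈ I₁, ∀ t ∈ I₂, f₃ s t = k₃ / ((s - c₂) * Real.cos (t / k₂ - c₃))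

def Family7 (I₁ I₂ : Set ℝ) (f₂ : ℝ → ℝ) (f₃ : ℝ → ℝ → ℝ) : Prop :=
  ∃ k₂ k₃ c₁ c₂ c₃ : ℝ, k₂ ≠ 0 ∧ k₃ ≠ 0 ∧ c₁ ≠ 0 ∧ c₂ ∉ I₁ ∧
    (∀ s ∈ I₁, ∀ t ∈ I₂, 1 + c₁ * (s - c₂) * Real.cos (t / k₂ - c₃) ≠ 0) ∧
    (∀ s ∈ I₁, f₂ s = k₂ / (s - c₂)) ∧
    ∀ s ∈ I₁, ∀ t ∈ I₂, f₃ s t = k₃ / (1 + c₁ * (s - c₂) * Real.cos (t / k₂ - c₃))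

/-! Put `P = 1 / f₂`, `Q = 1 / f₃`. The metric is a warped product with fibre `dx³` over the surface
with metric `(dx¹)² + P² (dx²)²`, so it is flat exactly when this surface is flat (`P'' = 0`) and
the Hessian of `Q` on it vanishes; `HasSeqWarpedJet.isFlatOn_iff` writes this in coordinates.

A function with zero Hessian on a flat surface is affine in Cartesian coordinates. If `P` is
constant, `(x¹, x²)` are Cartesian up to scale and `Q` is affine in them. Otherwise `P = a (x¹ -
c)`, so `r = x¹ - c` and `θ = a x²` are polar coordinates (with signed radius), and `Q = r (α cos θ
+ β sin θ) + γ`, that is, `r R cos (θ - δ) + γ`. This dichotomy is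
`HasSeqWarpedJet.isAffinePair_or_isPolarPair`; the two `isFlatOn` lemmas are its converse.

The seven families are the reciprocals of these solutions, sorted by which coefficients vanish
(`isAffinePair_iff`, `isPolarPair_iff`). The product claims are read off from the diagonal form of
the metric. -/

/-! ### Gradients of functions on `Fin 3 → ℝ` -/

/-- `a` is the vector of partial derivatives at `x` of `F`, which is differentiable at `x`. -/
def HasGrad (F : (Fin 3 → ℝ) → ℝ) (a : Fin 3 → ℝ) (x : Fin 3 → ℝ) : Prop :=
  HasFDerivAt F (∑ i, a i • ContinuousLinearMap.proj (R := ℝ) (φ := fun _ : Fin 3 => ℝ) i) x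

namespace HasGrad

variable {F G : (Fin 3 → ℝ) → ℝ} {a b : Fin 3 → ℝ} {x : Fin 3 → ℝ}

theorem partialDeriv_eq (h : HasGrad F a x) (i : Fin 3) : partialDeriv i F x = a i := by
  unfold partialDeriv
  rw [HasFDerivAt.fderiv h]
  simp [Pi.single_apply]

theorem congr_grad (h : HasGrad F a x) (hab : ∀ i, a i = b i) : HasGrad F b x := by
  rwa [← funext hab]

theorem congr_of_eventuallyEq (h : HasGrad F a x) (hFG : G =ᶠ[nhds x] F) : HasGrad G a x :=
  HasFDerivAt.congr_of_eventuallyEq h hFG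

theorem const (c : ℝ) (x : Fin 3 → ℝ) : HasGrad (fun _ => c) (fun _ => 0) x := by
  unfold HasGrad
  simpa using hasFDerivAt_const c x

theorem of_hasFDerivAt {L : (Fin 3 → ℝ) →L[ℝ] ℝ} (h : HasFDerivAt F L x)
    (hL : ∀ v, L v = ∑ i, a i * v i) : HasGrad F a x := by
  have hLa : L = ∑ i, a i • ContinuousLinearMap.proj (R := ℝ) (φ := fun _ : Fin 3 => ℝ) i :=
    ContinuousLinearMap.ext fun v => by simp [hL]
  rwa [HasGrad, ← hLa]

theorem sum_apply (a v : Fin 3 → ℝ) :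
    (∑ i, a i • ContinuousLinearMap.proj (R := ℝ) (φ := fun _ : Fin 3 => ℝ) i) v =
      ∑ i, a i * v i := by
  simp

theorem coord (j : Fin 3) (x : Fin 3 → ℝ) : HasGrad (fun y => y j) (Pi.single j 1) x :=
  of_hasFDerivAt (ContinuousLinearMap.proj (R := ℝ) (φ := fun _ : Fin 3 => ℝ) j).hasFDerivAt
    fun v => by simp [Pi.single_apply]

theorem add (hF : HasGrad F a x) (hG : HasGrad G b x) :
    HasGrad (fun y => F y + G y) (fun i => a i + b i) x :=
  of_hasFDerivAt (HasFDerivAt.add hF hG) fun v => by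
    rw [add_apply, sum_apply, sum_apply, ← Finset.sum_add_distrib]
    exact Finset.sum_congr rfl fun i _ => by ring

theorem neg (hF : HasGrad F a x) : HasGrad (fun y => -F y) (fun i => -a i) x :=
  of_hasFDerivAt (HasFDerivAt.neg hF) fun v => by
    rw [neg_apply, sum_apply, ← Finset.sum_neg_distrib]
    exact Finset.sum_congr rfl fun i _ => by ring

theorem sub (hF : HasGrad F a x) (hG : HasGrad G b x) :
    HasGrad (fun y => F y - G y) (fun i => a i - b i) x := by
  simpa [sub_eq_add_neg] using hF.add hG.neg

theorem mul (hF : HasGrad F a x) (hG : HasGrad G b x) :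
    HasGrad (fun y => F y * G y) (fun i => F x * b i + a i * G x) x :=
  of_hasFDerivAt (HasFDerivAt.mul hF hG) fun v => by
    rw [add_apply, smul_apply,
      smul_apply, sum_apply, sum_apply, smul_eq_mul, smul_eq_mul,
      Finset.mul_sum, Finset.mul_sum, ← Finset.sum_add_distrib]
    exact Finset.sum_congr rfl fun i _ => by ring

theorem comp {f : ℝ → ℝ} {f' : ℝ} (hf : HasDerivAt f f' (F x)) (hF : HasGrad F a x) :
    HasGrad (fun y => f (F y)) (fun i => f' * a i) x :=
  of_hasFDerivAt (hf.comp_hasFDerivAt x hF) fun v => by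
    rw [smul_apply, sum_apply, smul_eq_mul, Finset.mul_sum]
    exact Finset.sum_congr rfl fun i _ => by ring

theorem sq (hF : HasGrad F a x) : HasGrad (fun y => F y ^ 2) (fun i => 2 * F x * a i) x := by
  refine (comp (f := fun r => r ^ 2) (hasDerivAt_pow 2 (F x)) hF).congr_grad fun i => ?_
  simp

theorem inv (hF : HasGrad F a x) (h0 : F x ≠ 0) :
    HasGrad (fun y => (F y)⁻¹) (fun i => -a i / F x ^ 2) x := by
  refine (comp (hasDerivAt_inv h0) hF).congr_grad fun i => ?_
  ring

theorem div (hF : HasGrad F a x) (hG : HasGrad G b x) (h0 : G x ≠ 0) :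
    HasGrad (fun y => F y / G y) (fun i => a i / G x - F x * b i / G x ^ 2) x := by
  simp only [div_eq_mul_inv]
  refine (hF.mul (hG.inv h0)).congr_grad fun i => ?_
  field_simp
  ring

theorem eq_of_forall_zero {U : Set (Fin 3 → ℝ)} (hU : IsOpen U) (hc : IsPreconnected U)
    (h : ∀ x ∈ U, HasGrad F (fun _ => 0) x) {x y : Fin 3 → ℝ} (hx : x ∈ U) (hy : y ∈ U) :
    F x = F y := by
  have h' : ∀ x ∈ U, HasFDerivAt F (0 : (Fin 3 → ℝ) →L[ℝ] ℝ) x := fun x hx => by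
    simpa [HasGrad] using h x hx
  exact hU.is_const_of_fderiv_eq_zero hc
    (fun z hz => (h' z hz).differentiableAt.differentiableWithinAt)
    (fun z hz => (h' z hz).fderiv) hx hy

end HasGrad

/-! ### The curvature of `(dx^1)² + P² (dx^2)² + Q² (dx^3)²` -/

/-- The functions `P` and `Q` on `U` depend on `x^1` and on `(x^1, x^2)` only; the other ones are
their partial derivatives up to the second order. -/
structure HasSeqWarpedJet (U : Set (Fin 3 → ℝ))
    (P P' P'' Q Qs Qt Qss Qst Qts Qtt : (Fin 3 → ℝ) → ℝ) : Prop where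
  P_ne : ∀ x ∈ U, P x ≠ 0
  Q_ne : ∀ x ∈ U, Q x ≠ 0
  P_grad : ∀ x ∈ U, HasGrad P ![P' x, 0, 0] x
  P'_grad : ∀ x ∈ U, HasGrad P' ![P'' x, 0, 0] x
  Q_grad : ∀ x ∈ U, HasGrad Q ![Qs x, Qt x, 0] x
  Qs_grad : ∀ x ∈ U, HasGrad Qs ![Qss x, Qst x, 0] x
  Qt_grad : ∀ x ∈ U, HasGrad Qt ![Qts x, Qtt x, 0] x

/-- The Christoffel symbols `Γ^k_{ij}` of a sequential warped product metric, in terms of the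
values of the warping functions and of their first derivatives. -/
noncomputable def seqChristoffel (p p' q qs qt : ℝ) (k i j : Fin 3) : ℝ :=
  (![!![0, 0, 0; 0, -(p * p'), 0; 0, 0, -(q * qs)],
     !![0, p' / p, 0; p' / p, 0, 0; 0, 0, -(q * qt) / p ^ 2],
     !![0, 0, qs / q; 0, 0, qt / q; qs / q, qt / q, 0]] : Fin 3 → Matrix (Fin 3) (Fin 3) ℝ) k i j

/-- The differential of `seqChristoffel`. -/
noncomputable def seqChristoffelDeriv (p p' q qs qt dp dp' dq dqs dqt : ℝ) (k i j : Fin 3) : ℝ :=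
  (![!![0, 0, 0; 0, -(p * dp' + dp * p'), 0; 0, 0, -(q * dqs + dq * qs)],
     !![0, dp' / p - p' * dp / p ^ 2, 0; dp' / p - p' * dp / p ^ 2, 0, 0;
        0, 0, -(q * dqt + dq * qt) / p ^ 2 + 2 * (q * qt) * dp / p ^ 3],
     !![0, 0, dqs / q - qs * dq / q ^ 2; 0, 0, dqt / q - qt * dq / q ^ 2;
        dqs / q - qs * dq / q ^ 2, dqt / q - qt * dq / q ^ 2, 0]] :
    Fin 3 → Matrix (Fin 3) (Fin 3) ℝ) k i j

theorem HasGrad.seqChristoffel {P P' Q Qs Qt : (Fin 3 → ℝ) → ℝ} {a a' b bs bt x : Fin 3 → ℝ}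
    (hP : HasGrad P a x) (hP' : HasGrad P' a' x) (hQ : HasGrad Q b x) (hQs : HasGrad Qs bs x)
    (hQt : HasGrad Qt bt x) (hP0 : P x ≠ 0) (hQ0 : Q x ≠ 0) (k i j : Fin 3) :
    HasGrad (fun y => seqChristoffel (P y) (P' y) (Q y) (Qs y) (Qt y) k i j)
      (fun l => seqChristoffelDeriv (P x) (P' x) (Q x) (Qs x) (Qt x)
        (a l) (a' l) (b l) (bs l) (bt l) k i j) x := by
  -- Up to the symmetry in `i`, `j` there are six nonzero symbols; every entry is one of them or
  -- zero.
  have h1 := (hP.mul hP').neg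
  have h2 := (hQ.mul hQs).neg
  have h3 := hP'.div hP hP0
  have h4 : HasGrad (fun y => -(Q y * Qt y) / P y ^ 2)
      (fun l => -(Q x * bt l + b l * Qt x) / P x ^ 2 + 2 * (Q x * Qt x) * a l / P x ^ 3) x := by
    refine ((hQ.mul hQt).neg.div hP.sq (pow_ne_zero 2 hP0)).congr_grad fun l => ?_
    field_simp
    ring
  have h5 := hQs.div hQ hQ0
  have h6 := hQt.div hQ hQ0
  have h0 := HasGrad.const 0 x
  fin_cases k <;> fin_cases i <;> fin_cases j <;>
    first | exact h0 | exact h1 | exact h2 | exact h3 | exact h4 | exact h5 | exact h6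

section Curvature

variable {U : Set (Fin 3 → ℝ)} {P P' P'' Q Qs Qt Qss Qst Qts Qtt : (Fin 3 → ℝ) → ℝ}
  {g : (Fin 3 → ℝ) → Matrix (Fin 3) (Fin 3) ℝ}

theorem inv_diagonal_vec_three (p q : ℝ) (hp : p ≠ 0) (hq : q ≠ 0) :
    (Matrix.diagonal ![1, p ^ 2, q ^ 2])⁻¹ = Matrix.diagonal ![1, (p ^ 2)⁻¹, (q ^ 2)⁻¹] := by
  apply Matrix.inv_eq_right_inv
  rw [Matrix.diagonal_mul_diagonal, ← Matrix.diagonal_one]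
  congr 1
  ext i
  fin_cases i <;> simp [hp, hq]

theorem HasSeqWarpedJet.christoffel_eq
    (hJ : HasSeqWarpedJet U P P' P'' Q Qs Qt Qss Qst Qts Qtt) (hU : IsOpen U)
    (hg : ∀ x ∈ U, g x = Matrix.diagonal ![1, P x ^ 2, Q x ^ 2])
    {x : Fin 3 → ℝ} (hx : x ∈ U) (k i j : Fin 3) :
    christoffel g k i j x = seqChristoffel (P x) (P' x) (Q x) (Qs x) (Qt x) k i j := by
  have hP0 := hJ.P_ne x hx
  have hQ0 := hJ.Q_ne x hx
  have hev : ∀ᶠ y in nhds x, g y = Matrix.diagonal ![1, P y ^ 2, Q y ^ 2] := by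
    filter_upwards [hU.mem_nhds hx] with y hy using hg y hy
  have hd : ∀ l i j, partialDeriv l (fun y => g y i j) x =
      Matrix.diagonal ![0, 2 * P x * ![P' x, 0, 0] l, 2 * Q x * ![Qs x, Qt x, 0] l] i j := by
    intro l i j
    have hc : HasGrad (fun y => g y i j) (fun l => Matrix.diagonal
        ![0, 2 * P x * ![P' x, 0, 0] l, 2 * Q x * ![Qs x, Qt x, 0] l] i j) x := by
      refine HasGrad.congr_of_eventuallyEq
        (F := fun y => Matrix.diagonal ![1, P y ^ 2, Q y ^ 2] i j) ?_
        (hev.mono fun y hy => by simp only [hy])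
      have h0 := HasGrad.const 0 x
      have h1 := HasGrad.const 1 x
      have h2 := (hJ.P_grad x hx).sq
      have h3 := (hJ.Q_grad x hx).sq
      fin_cases i <;> fin_cases j <;>
        first | exact h0 | exact h1 | exact h2 | exact h3
    exact hc.partialDeriv_eq l
  unfold christoffel
  simp only [hd]
  rw [hg x hx, inv_diagonal_vec_three _ _ hP0 hQ0]
  fin_cases k <;> fin_cases i <;> fin_cases j <;>
    simp [seqChristoffel, Matrix.diagonal_apply] <;> field_simp

/-- The closed form of the Christoffel symbols holds on all of the open set `U`, hence near `x`, and
may be differentiated there. -/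
theorem HasSeqWarpedJet.riemannCoeff_eq
    (hJ : HasSeqWarpedJet U P P' P'' Q Qs Qt Qss Qst Qts Qtt) (hU : IsOpen U)
    (hg : ∀ x ∈ U, g x = Matrix.diagonal ![1, P x ^ 2, Q x ^ 2])
    {x : Fin 3 → ℝ} (hx : x ∈ U) (l i j k : Fin 3) :
    let Γ := seqChristoffel (P x) (P' x) (Q x) (Qs x) (Qt x)
    let dΓ := fun i => seqChristoffelDeriv (P x) (P' x) (Q x) (Qs x) (Qt x) (![P' x, 0, 0] i)
      (![P'' x, 0, 0] i) (![Qs x, Qt x, 0] i) (![Qss x, Qst x, 0] i) (![Qts x, Qtt x, 0] i)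
    riemannCoeff g l i j k x =
      dΓ i l j k - dΓ j l i k + ∑ m, (Γ l i m * Γ m j k - Γ l j m * Γ m i k) := by
  intro Γ dΓ
  have hd : ∀ i l j k, partialDeriv i (christoffel g l j k) x = dΓ i l j k := by
    intro i l j k
    refine HasGrad.partialDeriv_eq (HasGrad.congr_of_eventuallyEq
      ((hJ.P_grad x hx).seqChristoffel (hJ.P'_grad x hx) (hJ.Q_grad x hx) (hJ.Qs_grad x hx)
        (hJ.Qt_grad x hx) (hJ.P_ne x hx) (hJ.Q_ne x hx) l j k) ?_) i
    filter_upwards [hU.mem_nhds hx] with y hy using hJ.christoffel_eq hU hg hy l j k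
  simp only [riemannCoeff, hd, hJ.christoffel_eq hU hg hx, Γ]

/-- The first equation is flatness of the base surface, the others the vanishing of the Hessian of
`Q` on it. The two mixed derivatives are kept apart and come from different curvature components, so
their symmetry is never invoked. -/
theorem HasSeqWarpedJet.isFlatOn_iff
    (hJ : HasSeqWarpedJet U P P' P'' Q Qs Qt Qss Qst Qts Qtt) (hU : IsOpen U)
    (hg : ∀ x ∈ U, g x = Matrix.diagonal ![1, P x ^ 2, Q x ^ 2]) :
    IsFlatOn U g ↔ ∀ x ∈ U, P'' x = 0 ∧ Qss x = 0 ∧ Qst x = P' x * Qt x / P x ∧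
      Qts x = P' x * Qt x / P x ∧ Qtt x = -(P x * P' x * Qs x) := by
  refine forall₂_congr fun x hx => ?_
  have hP0 := hJ.P_ne x hx
  have hQ0 := hJ.Q_ne x hx
  simp only [hJ.riemannCoeff_eq hU hg hx]
  constructor
  · intro h
    -- These five components isolate `P''`, `Qss`, `Qst`, `Qts` and `Qtt` respectively.
    have h1 := h 1 0 1 0
    have h2 := h 2 0 2 0
    have h3 := h 0 1 2 2
    have h4 := h 2 0 2 1
    have h5 := h 2 1 2 1
    simp [Fin.sum_univ_three, seqChristoffel, seqChristoffelDeriv] at h1 h2 h3 h4 h5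
    field_simp at h1 h2 h3 h4 h5
    refine ⟨?_, ?_, ?_, ?_, ?_⟩
    · exact mul_right_cancel₀ hP0 (by linear_combination h1)
    · exact mul_right_cancel₀ hQ0 (by linear_combination h2)
    · rw [eq_div_iff hP0]
      exact mul_right_cancel₀ hQ0 (by linear_combination -h3)
    · rw [eq_div_iff hP0]
      exact mul_right_cancel₀ hQ0 (by linear_combination h4)
    · exact mul_right_cancel₀ hQ0 (by linear_combination h5)
  · rintro ⟨h1, h2, h3, h4, h5⟩ l i j k
    rw [h1, h2, h3, h4, h5]
    fin_cases l <;> fin_cases i <;> fin_cases j <;> fin_cases k <;>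
      simp [Fin.sum_univ_three, seqChristoffel, seqChristoffelDeriv] <;> field_simp <;> ring

end Curvature

/-! ### Partial derivatives of smooth functions -/

section Smooth

variable {F : (Fin 3 → ℝ) → ℝ} {U : Set (Fin 3 → ℝ)}

theorem DifferentiableAt.hasGrad {x : Fin 3 → ℝ} (h : DifferentiableAt ℝ F x) :
    HasGrad F (fun i => partialDeriv i F x) x :=
  HasGrad.of_hasFDerivAt h.hasFDerivAt fun v => by
    conv_lhs => rw [← Finset.univ_sum_single v]
    rw [map_sum]
    refine Finset.sum_congr rfl fun i _ => ?_
    have hv : (Pi.single i (v i) : Fin 3 → ℝ) = v i • Pi.single i 1 := by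
      rw [← Pi.single_smul, smul_eq_mul, mul_one]
    rw [hv, map_smul, partialDeriv, smul_eq_mul, mul_comm]

theorem ContDiffOn.partialDeriv (hU : IsOpen U) (h : ContDiffOn ℝ ∞ F U) (i : Fin 3) :
    ContDiffOn ℝ ∞ (partialDeriv i F) U :=
  (h.fderiv_of_isOpen hU (m := ∞) (by simp)).clm_apply contDiffOn_const

theorem ContDiffOn.hasGrad (hU : IsOpen U) (h : ContDiffOn ℝ ∞ F U) {x : Fin 3 → ℝ}
    (hx : x ∈ U) : HasGrad F (fun i => _root_.partialDeriv i F x) x :=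
  ((h.contDiffAt (hU.mem_nhds hx)).differentiableAt (by simp)).hasGrad

/-- `F` does not depend on the `i`-th coordinate. -/
def IndepOfCoord (i : Fin 3) (F : (Fin 3 → ℝ) → ℝ) : Prop :=
  ∀ (x : Fin 3 → ℝ) (r : ℝ), F (x + r • Pi.single i 1) = F x

/-- `fderiv` commutes with translations, also at points where `F` is not differentiable. -/
theorem IndepOfCoord.partialDeriv {i : Fin 3} (h : IndepOfCoord i F) (j : Fin 3) :
    IndepOfCoord i (partialDeriv j F) := by
  intro x r
  have hF : (fun y => F (y + r • Pi.single i 1)) = F := funext fun y => h y r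
  unfold _root_.partialDeriv
  rw [← fderiv_comp_add_right, hF]

theorem IndepOfCoord.partialDeriv_eq_zero {i : Fin 3} (h : IndepOfCoord i F)
    (x : Fin 3 → ℝ) : _root_.partialDeriv i F x = 0 := by
  unfold _root_.partialDeriv
  by_cases hd : DifferentiableAt ℝ F x
  · rw [← hd.lineDeriv_eq_fderiv]
    simp [lineDeriv, h x]
  -- The default value of `fderiv` is zero.
  · simp [fderiv_zero_of_not_differentiableAt hd]

theorem HasSeqWarpedJet.of_contDiffOn {P Q : (Fin 3 → ℝ) → ℝ} (hU : IsOpen U)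
    (hP : ContDiffOn ℝ ∞ P U) (hQ : ContDiffOn ℝ ∞ Q U) (hP0 : ∀ x ∈ U, P x ≠ 0)
    (hQ0 : ∀ x ∈ U, Q x ≠ 0) (hP1 : IndepOfCoord 1 P) (hP2 : IndepOfCoord 2 P)
    (hQ2 : IndepOfCoord 2 Q) :
    HasSeqWarpedJet U P (partialDeriv 0 P) (partialDeriv 0 (partialDeriv 0 P)) Q
      (partialDeriv 0 Q) (partialDeriv 1 Q) (partialDeriv 0 (partialDeriv 0 Q))
      (partialDeriv 1 (partialDeriv 0 Q)) (partialDeriv 0 (partialDeriv 1 Q))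
      (partialDeriv 1 (partialDeriv 1 Q)) := by
  have key : ∀ {F}, ContDiffOn ℝ ∞ F U → IndepOfCoord 2 F →
      ∀ x ∈ U, HasGrad F ![partialDeriv 0 F x, partialDeriv 1 F x, 0] x := by
    intro F hF h2 x hx
    refine (hF.hasGrad hU hx).congr_grad fun i => ?_
    fin_cases i
    · rfl
    · rfl
    · exact h2.partialDeriv_eq_zero x
  have key' : ∀ {F}, ContDiffOn ℝ ∞ F U → IndepOfCoord 1 F → IndepOfCoord 2 F →
      ∀ x ∈ U, HasGrad F ![partialDeriv 0 F x, 0, 0] x := by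
    intro F hF h1 h2 x hx
    have := key hF h2 x hx
    rwa [h1.partialDeriv_eq_zero x] at this
  exact ⟨hP0, hQ0, key' hP hP1 hP2,
    key' (hP.partialDeriv hU 0) (hP1.partialDeriv 0) (hP2.partialDeriv 0), key hQ hQ2,
    key (hQ.partialDeriv hU 0) (hQ2.partialDeriv 0),
    key (hQ.partialDeriv hU 1) (hQ2.partialDeriv 1)⟩

end Smooth

/-! ### Solution of the flatness equations -/

/-- `R` and `δ` are the modulus and argument of `α + iβ`. -/
theorem exists_mul_cos_sub (α β : ℝ) :
    ∃ R δ : ℝ, ∀ y, α * Real.cos y + β * Real.sin y = R * Real.cos (y - δ) := by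
  refine ⟨‖(⟨α, β⟩ : ℂ)‖, Complex.arg ⟨α, β⟩, fun y => ?_⟩
  have h1 := Complex.norm_mul_cos_arg ⟨α, β⟩
  have h2 := Complex.norm_mul_sin_arg ⟨α, β⟩
  simp only at h1 h2
  rw [Real.cos_sub]
  linear_combination -Real.cos y * h1 - Real.sin y * h2

section Solve

variable {U : Set (Fin 3 → ℝ)} {P P' P'' Q Qs Qt Qss Qst Qts Qtt : (Fin 3 → ℝ) → ℝ}

/-- The warping functions of a flat sequential warped product with constant `P`. -/
def IsAffinePair (U : Set (Fin 3 → ℝ)) (P Q : (Fin 3 → ℝ) → ℝ) : Prop :=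
  ∃ a α β γ : ℝ, ∀ x ∈ U, P x = a ∧ Q x = α * x 0 + β * x 1 + γ

/-- The warping functions of a flat sequential warped product with nonconstant `P`. -/
def IsPolarPair (U : Set (Fin 3 → ℝ)) (P Q : (Fin 3 → ℝ) → ℝ) : Prop :=
  ∃ a c R δ γ : ℝ, a ≠ 0 ∧ ∀ x ∈ U, P x = a * (x 0 - c) ∧
    Q x = (x 0 - c) * (R * Real.cos (a * x 1 - δ)) + γ

/-- The system is integrated by exhibiting first integrals: functions whose gradient vanishes by the
equations, hence constant on the connected set `U`. -/
theorem HasSeqWarpedJet.isAffinePair_or_isPolarPair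
    (hJ : HasSeqWarpedJet U P P' P'' Q Qs Qt Qss Qst Qts Qtt) (hU : IsOpen U)
    (hc : IsPreconnected U) (hne : U.Nonempty)
    (h : ∀ x ∈ U, P'' x = 0 ∧ Qss x = 0 ∧ Qst x = P' x * Qt x / P x ∧
      Qts x = P' x * Qt x / P x ∧ Qtt x = -(P x * P' x * Qs x)) :
    IsAffinePair U P Q ∨ IsPolarPair U P Q := by
  obtain ⟨z, hz⟩ := hne
  have const_of : ∀ {F : (Fin 3 → ℝ) → ℝ}, (∀ x ∈ U, HasGrad F (fun _ => 0) x) →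
      ∀ x ∈ U, F x = F z := fun hF x hx => HasGrad.eq_of_forall_zero hU hc hF hx hz
  have hP' : ∀ x ∈ U, P' x = P' z := const_of fun x hx =>
    (hJ.P'_grad x hx).congr_grad fun i => by
      fin_cases i <;> simp [(h x hx).1]
  -- `P'` is constant; its vanishing decides between Cartesian and polar coordinates on the base.
  by_cases ha : P' z = 0
  · left
    have hP : ∀ x ∈ U, P x = P z := const_of fun x hx =>
      (hJ.P_grad x hx).congr_grad fun i => by fin_cases i <;> simp [hP' x hx, ha]
    have hQs : ∀ x ∈ U, Qs x = Qs z := const_of fun x hx =>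
      (hJ.Qs_grad x hx).congr_grad fun i => by
        obtain ⟨-, h2, h3, -, -⟩ := h x hx
        fin_cases i <;> simp [h2, h3, hP' x hx, ha]
    have hQt : ∀ x ∈ U, Qt x = Qt z := const_of fun x hx =>
      (hJ.Qt_grad x hx).congr_grad fun i => by
        obtain ⟨-, -, -, h4, h5⟩ := h x hx
        fin_cases i <;> simp [h4, h5, hP' x hx, ha]
    have hQ : ∀ x ∈ U, Q x - Qs z * x 0 - Qt z * x 1 = Q z - Qs z * z 0 - Qt z * z 1 := by
      refine const_of (F := fun x => Q x - Qs z * x 0 - Qt z * x 1) fun x hx => ?_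
      refine (((hJ.Q_grad x hx).sub ((HasGrad.const (Qs z) x).mul (HasGrad.coord 0 x))).sub
        ((HasGrad.const (Qt z) x).mul (HasGrad.coord 1 x))).congr_grad fun i => ?_
      fin_cases i <;> simp [hQs x hx, hQt x hx]
    exact ⟨P z, Qs z, Qt z, Q z - Qs z * z 0 - Qt z * z 1,
      fun x hx => ⟨hP x hx, by linear_combination hQ x hx⟩⟩
  · right
    set a := P' z with ha_def
    obtain ⟨c, hPc⟩ : ∃ c, ∀ x ∈ U, P x = a * (x 0 - c) := by
      have hP : ∀ x ∈ U, P x - a * x 0 = P z - a * z 0 := by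
        refine const_of (F := fun x => P x - a * x 0) fun x hx => ?_
        refine ((hJ.P_grad x hx).sub
          ((HasGrad.const a x).mul (HasGrad.coord 0 x))).congr_grad fun i => ?_
        fin_cases i <;> simp [hP' x hx]
      refine ⟨-(P z - a * z 0) / a, fun x hx => ?_⟩
      field_simp
      linear_combination hP x hx
    have hw : ∀ x ∈ U, x 0 - c ≠ 0 := fun x hx h0 => hJ.P_ne x hx (by rw [hPc x hx, h0, mul_zero])
    have hgw : ∀ x, HasGrad (fun y => y 0 - c) (fun i => Pi.single (M := fun _ => ℝ) 0 1 i - 0) x :=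
      fun x => (HasGrad.coord 0 x).sub (HasGrad.const c x)
    have hgs : ∀ x, HasGrad (fun y => Real.sin (a * y 1))
        (fun i => Real.cos (a * x 1) * (a * Pi.single (M := fun _ => ℝ) 1 1 i + 0 * x 1)) x :=
      fun x => HasGrad.comp (F := fun y => a * y 1) (Real.hasDerivAt_sin _)
        ((HasGrad.const a x).mul (HasGrad.coord 1 x))
    have hgc : ∀ x, HasGrad (fun y => Real.cos (a * y 1))
        (fun i => -Real.sin (a * x 1) * (a * Pi.single (M := fun _ => ℝ) 1 1 i + 0 * x 1)) x :=
      fun x => HasGrad.comp (F := fun y => a * y 1) (Real.hasDerivAt_cos _)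
        ((HasGrad.const a x).mul (HasGrad.coord 1 x))
    have hgq : ∀ x ∈ U, HasGrad (fun y => Qt y / (a * (y 0 - c))) _ x := fun x hx =>
      (hJ.Qt_grad x hx).div ((HasGrad.const a x).mul (hgw x)) (mul_ne_zero ha (hw x hx))
    -- `Q` is an affine function of the Cartesian coordinates associated with the polar
    -- coordinates `x 0 - c` and `a * x 1`.
    let A : (Fin 3 → ℝ) → ℝ := fun x =>
      Real.cos (a * x 1) * Qs x - Real.sin (a * x 1) * (Qt x / (a * (x 0 - c)))
    let B : (Fin 3 → ℝ) → ℝ := fun x =>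
      Real.sin (a * x 1) * Qs x + Real.cos (a * x 1) * (Qt x / (a * (x 0 - c)))
    let C : (Fin 3 → ℝ) → ℝ := fun x => Q x - (x 0 - c) * Qs x
    -- `A` and `B` are the Cartesian components of the gradient of `Q`, obtained by rotating its
    -- radial part `Qs` and angular part `Qt / (a r)`; `C` is the remaining constant term.
    have hA : ∀ x ∈ U, A x = A z := const_of fun x hx => by
      refine (((hgc x).mul (hJ.Qs_grad x hx)).sub ((hgs x).mul (hgq x hx))).congr_grad fun i => ?_
      obtain ⟨-, h2, h3, h4, h5⟩ := h x hx
      have hw := hw x hx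
      rw [hP' x hx, hPc x hx] at h3 h4 h5
      fin_cases i <;> simp [h2, h3, h4, h5, -mul_eq_zero] <;> field_simp <;> ring
    have hB : ∀ x ∈ U, B x = B z := const_of fun x hx => by
      refine (((hgs x).mul (hJ.Qs_grad x hx)).add ((hgc x).mul (hgq x hx))).congr_grad fun i => ?_
      obtain ⟨-, h2, h3, h4, h5⟩ := h x hx
      have hw := hw x hx
      rw [hP' x hx, hPc x hx] at h3 h4 h5
      fin_cases i <;> simp [h2, h3, h4, h5, -mul_eq_zero] <;> field_simp <;> ring
    have hC : ∀ x ∈ U, C x = C z := const_of fun x hx => by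
      refine ((hJ.Q_grad x hx).sub ((hgw x).mul (hJ.Qs_grad x hx))).congr_grad fun i => ?_
      obtain ⟨-, h2, h3, -, -⟩ := h x hx
      have hw := hw x hx
      rw [hP' x hx, hPc x hx] at h3
      fin_cases i <;> simp [h2, h3] <;> field_simp <;> ring
    obtain ⟨R, δ, hR⟩ := exists_mul_cos_sub (A z) (B z)
    refine ⟨a, c, R, δ, C z, ha, fun x hx => ⟨hPc x hx, ?_⟩⟩
    rw [← hR, ← hA x hx, ← hB x hx, ← hC x hx]
    simp only [A, B, C]
    linear_combination -(x 0 - c) * Qs x * Real.sin_sq_add_cos_sq (a * x 1)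

/-- On `U` the metric coincides with that of the explicit solution, whose derivatives are written
down and checked against the flatness equations. -/
theorem IsAffinePair.isFlatOn {g : (Fin 3 → ℝ) → Matrix (Fin 3) (Fin 3) ℝ} (hU : IsOpen U)
    (hg : ∀ x ∈ U, g x = Matrix.diagonal ![1, P x ^ 2, Q x ^ 2]) (hP0 : ∀ x ∈ U, P x ≠ 0)
    (hQ0 : ∀ x ∈ U, Q x ≠ 0) (h : IsAffinePair U P Q) : IsFlatOn U g := by
  obtain ⟨a, α, β, γ, h⟩ := h
  have hJ : HasSeqWarpedJet U (fun _ => a) (fun _ => 0) (fun _ => 0)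
      (fun x => α * x 0 + β * x 1 + γ) (fun _ => α) (fun _ => β) (fun _ => 0) (fun _ => 0)
      (fun _ => 0) (fun _ => 0) := by
    have h0 : ∀ c x, HasGrad (fun _ => c) ![0, 0, 0] x := fun c x =>
      (HasGrad.const c x).congr_grad fun i => by fin_cases i <;> rfl
    refine ⟨fun x hx => (h x hx).1 ▸ hP0 x hx, fun x hx => (h x hx).2 ▸ hQ0 x hx,
      fun x _ => h0 _ x, fun x _ => h0 _ x, fun x _ => ?_, fun x _ => h0 _ x, fun x _ => h0 _ x⟩
    refine ((((HasGrad.const α x).mul (HasGrad.coord 0 x)).add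
      ((HasGrad.const β x).mul (HasGrad.coord 1 x))).add (HasGrad.const γ x)).congr_grad
      fun i => ?_
    fin_cases i <;> simp
  refine (hJ.isFlatOn_iff hU fun x hx => ?_).2 fun x _ => by simp
  rw [hg x hx, (h x hx).1, (h x hx).2]

theorem IsPolarPair.isFlatOn {g : (Fin 3 → ℝ) → Matrix (Fin 3) (Fin 3) ℝ} (hU : IsOpen U)
    (hg : ∀ x ∈ U, g x = Matrix.diagonal ![1, P x ^ 2, Q x ^ 2]) (hP0 : ∀ x ∈ U, P x ≠ 0)
    (hQ0 : ∀ x ∈ U, Q x ≠ 0) (h : IsPolarPair U P Q) : IsFlatOn U g := by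
  obtain ⟨a, c, R, δ, γ, ha, h⟩ := h
  have hw : ∀ x ∈ U, x 0 - c ≠ 0 := fun x hx h0 => hP0 x hx (by rw [(h x hx).1, h0, mul_zero])
  have hgw : ∀ x, HasGrad (fun y => y 0 - c) (fun i => Pi.single (M := fun _ => ℝ) 0 1 i - 0) x :=
    fun x => (HasGrad.coord 0 x).sub (HasGrad.const c x)
  have hgθ : ∀ x, HasGrad (fun y => a * y 1 - δ)
      (fun i => (a * Pi.single (M := fun _ => ℝ) 1 1 i + 0 * x 1) - 0) x :=
    fun x => ((HasGrad.const a x).mul (HasGrad.coord 1 x)).sub (HasGrad.const δ x)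
  have hgs := fun x => HasGrad.comp (F := fun y => a * y 1 - δ) (Real.hasDerivAt_sin _) (hgθ x)
  have hgc := fun x => HasGrad.comp (F := fun y => a * y 1 - δ) (Real.hasDerivAt_cos _) (hgθ x)
  have hgRc := fun x => (HasGrad.const R x).mul (hgc x)
  have hJ : HasSeqWarpedJet U (fun x => a * (x 0 - c)) (fun _ => a) (fun _ => 0)
      (fun x => (x 0 - c) * (R * Real.cos (a * x 1 - δ)) + γ)
      (fun x => R * Real.cos (a * x 1 - δ))
      (fun x => (x 0 - c) * (-(R * a) * Real.sin (a * x 1 - δ))) (fun _ => 0)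
      (fun x => -(R * a) * Real.sin (a * x 1 - δ))
      (fun x => -(R * a) * Real.sin (a * x 1 - δ))
      (fun x => (x 0 - c) * (-(R * a ^ 2) * Real.cos (a * x 1 - δ))) := by
    refine ⟨fun x hx => (h x hx).1 ▸ hP0 x hx, fun x hx => (h x hx).2 ▸ hQ0 x hx,
      fun x _ => ((HasGrad.const a x).mul (hgw x)).congr_grad fun i => ?_,
      fun x _ => (HasGrad.const a x).congr_grad fun i => ?_,
      fun x _ => (((hgw x).mul (hgRc x)).add (HasGrad.const γ x)).congr_grad fun i => ?_,
      fun x _ => (hgRc x).congr_grad fun i => ?_,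
      fun x _ => ((hgw x).mul ((HasGrad.const (-(R * a)) x).mul (hgs x))).congr_grad fun i => ?_⟩
    all_goals fin_cases i <;> simp [-mul_eq_mul_left_iff] <;> ring
  refine (hJ.isFlatOn_iff hU fun x hx => ?_).2 fun x hx => ?_
  · rw [hg x hx, (h x hx).1, (h x hx).2]
  · have hw := hw x hx
    refine ⟨rfl, rfl, ?_, ?_, ?_⟩ <;> field_simp

end Solve

/-! ### The seven families -/

/-- The image of an interval under `a * t - δ` avoids the zeros of the cosine, so it stays between
two consecutive ones. This supplies the angle normalization in `Family6`. -/
theorem sub_mul_pi_abs_lt_of_cos_ne_zero {J : Set ℝ} (hJ : J.OrdConnected) {a δ : ℝ}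
    (h : ∀ t ∈ J, Real.cos (a * t - δ) ≠ 0) :
    ∃ n : ℤ, ∀ t ∈ J, |a * t - δ - n * Real.pi| < Real.pi / 2 := by
  rcases J.eq_empty_or_nonempty with rfl | ⟨t₀, ht₀⟩
  · exact ⟨0, by simp⟩
  have hne : ∀ n : ℤ, ∀ t ∈ J, |a * t - δ - n * Real.pi| ≠ Real.pi / 2 := by
    intro n t ht habs
    apply h t ht
    have hcos : Real.cos (a * t - δ - n * Real.pi) = 0 := by
      rw [← Real.cos_abs, habs, Real.cos_pi_div_two]
    rw [Real.cos_sub_int_mul_pi] at hcos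
    exact (mul_eq_zero.1 hcos).resolve_left (zpow_ne_zero _ (by norm_num))
  have hpi := Real.pi_pos
  -- `n * π` is the multiple of `π` nearest to the angle at `t₀`; leaving its interval would force
  -- the value `π / 2`.
  set n := round ((a * t₀ - δ) / Real.pi) with hn
  have h₀ : |a * t₀ - δ - n * Real.pi| ≤ Real.pi / 2 := by
    have := abs_sub_round ((a * t₀ - δ) / Real.pi)
    rw [← hn] at this
    have e : a * t₀ - δ - n * Real.pi = ((a * t₀ - δ) / Real.pi - n) * Real.pi := by
      field_simp
    rw [e, abs_mul, abs_of_pos hpi]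
    nlinarith
  refine ⟨n, fun t ht => ?_⟩
  by_contra! hlt
  have hcont : ContinuousOn (fun t => |a * t - δ - n * Real.pi|) J := by fun_prop
  obtain ⟨r, hr, hr'⟩ :=
    hJ.isPreconnected.intermediate_value ht₀ ht hcont ⟨h₀, hlt⟩
  exact hne n r hr hr'

section Families

variable {I : Fin 3 → Set ℝ} {f₂ : ℝ → ℝ} {f₃ : ℝ → ℝ → ℝ}

/-- A pair `(s, t)` lifts to the box because the third factor is nonempty. -/
theorem forall_mem_box_iff (hne : ∀ i, (I i).Nonempty) {p : ℝ → ℝ → Prop} :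
    (∀ x ∈ Set.univ.pi I, p (x 0) (x 1)) ↔ ∀ s ∈ I 0, ∀ t ∈ I 1, p s t := by
  obtain ⟨u, hu⟩ := hne 2
  refine ⟨fun h s hs t ht => h ![s, t, u] fun i _ => ?_,
    fun h x hx => h _ (hx 0 trivial) _ (hx 1 trivial)⟩
  fin_cases i
  exacts [hs, ht, hu]

theorem isAffinePair_iff (hne : ∀ i, (I i).Nonempty) (hf₂0 : ∀ s ∈ I 0, f₂ s ≠ 0)
    (hf₃0 : ∀ s ∈ I 0, ∀ t ∈ I 1, f₃ s t ≠ 0) :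
    IsAffinePair (Set.univ.pi I) (fun x => 1 / f₂ (x 0)) (fun x => 1 / f₃ (x 0) (x 1)) ↔
      Family1 (I 0) (I 1) f₂ f₃ ∨ Family2 (I 0) (I 1) f₂ f₃ ∨ Family3 (I 0) (I 1) f₂ f₃ ∨
      Family4 (I 0) (I 1) f₂ f₃ := by
  have hbox : ∀ a α β γ : ℝ, (∀ x ∈ Set.univ.pi I,
      1 / f₂ (x 0) = a ∧ 1 / f₃ (x 0) (x 1) = α * x 0 + β * x 1 + γ) ↔
      ∀ s ∈ I 0, ∀ t ∈ I 1, 1 / f₂ s = a ∧ 1 / f₃ s t = α * s + β * t + γ := fun a α β γ =>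
    forall_mem_box_iff hne (p := fun s t => 1 / f₂ s = a ∧ 1 / f₃ s t = α * s + β * t + γ)
  simp only [IsAffinePair, hbox]
  obtain ⟨s₀, hs₀⟩ := hne 0
  obtain ⟨t₀, ht₀⟩ := hne 1
  constructor
  · rintro ⟨a, α, β, γ, h⟩
    have h2 : ∀ s ∈ I 0, f₂ s = 1 / a := fun s hs => by rw [← (h s hs t₀ ht₀).1, one_div_one_div]
    have h3 : ∀ s ∈ I 0, ∀ t ∈ I 1, f₃ s t = 1 / (α * s + β * t + γ) := fun s hs t ht => by
      rw [← (h s hs t ht).2, one_div_one_div]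
    have ha : 1 / a ≠ 0 := h2 s₀ hs₀ ▸ hf₂0 s₀ hs₀
    -- Since division by zero gives zero, a zero of the denominator would be a zero of `f₃`.
    have hq : ∀ s ∈ I 0, ∀ t ∈ I 1, α * s + β * t + γ ≠ 0 := fun s hs t ht h0 =>
      hf₃0 s hs t ht (by rw [h3 s hs t ht, h0, div_zero])
    -- The four cases give families 1, 3, 2 and 4, in this order.
    by_cases hα : α = 0 <;> by_cases hβ : β = 0
    · subst hα hβ
      refine Or.inl ⟨1 / a, 1 / γ, ha, ?_, h2, fun s hs t ht => ?_⟩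
      · simpa using hq s₀ hs₀ t₀ ht₀
      · simpa using h3 s hs t ht
    · subst hα
      have e : ∀ s t, 0 * s + β * t + γ = β * (t - -γ / β) := fun s t => by field_simp; ring
      refine Or.inr (Or.inr (Or.inl ⟨1 / a, 1 / β, -γ / β, ha, one_div_ne_zero hβ,
        fun hc => hq s₀ hs₀ _ hc ?_, h2, fun s hs t ht => ?_⟩))
      · rw [e, sub_self, mul_zero]
      · rw [h3 s hs t ht, e, div_div]
    · subst hβ
      have e : ∀ s t, α * s + 0 * t + γ = α * (s - -γ / α) := fun s t => by field_simp; ring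
      refine Or.inr (Or.inl ⟨1 / a, 1 / α, -γ / α, ha, one_div_ne_zero hα,
        fun hc => hq _ hc t₀ ht₀ ?_, h2, fun s hs t ht => ?_⟩)
      · rw [e, sub_self, mul_zero]
      · rw [h3 s hs t ht, e, div_div]
    · have e : ∀ s t, α * s + β * t + γ = β * (α / β * s + t + γ / β) := fun s t => by field_simp
      refine Or.inr (Or.inr (Or.inr ⟨1 / a, 1 / β, α / β, γ / β, ha, one_div_ne_zero hβ,
        div_ne_zero hα hβ, fun s hs t ht h0 => hq s hs t ht ?_, h2, fun s hs t ht => ?_⟩))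
      · rw [e, h0, mul_zero]
      · rw [h3 s hs t ht, e, div_div]
  · rintro (⟨k₂, k₃, -, -, h2, h3⟩ | ⟨k₂, k₃, c₃, -, -, -, h2, h3⟩ |
      ⟨k₂, k₃, c₃, -, -, -, h2, h3⟩ | ⟨k₂, k₃, c₁, c₂, -, -, -, -, h2, h3⟩)
    · exact ⟨1 / k₂, 0, 0, 1 / k₃, fun s hs t ht => ⟨by rw [h2 s hs], by rw [h3 s hs t ht]; ring⟩⟩
    · exact ⟨1 / k₂, 1 / k₃, 0, -c₃ / k₃, fun s hs t ht =>
        ⟨by rw [h2 s hs], by rw [h3 s hs t ht, one_div_div]; ring⟩⟩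
    · exact ⟨1 / k₂, 0, 1 / k₃, -c₃ / k₃, fun s hs t ht =>
        ⟨by rw [h2 s hs], by rw [h3 s hs t ht, one_div_div]; ring⟩⟩
    · exact ⟨1 / k₂, c₁ / k₃, 1 / k₃, c₂ / k₃, fun s hs t ht =>
        ⟨by rw [h2 s hs], by rw [h3 s hs t ht, one_div_div]; ring⟩⟩

theorem isPolarPair_iff (hne : ∀ i, (I i).Nonempty) (hconn : ∀ i, (I i).OrdConnected)
    (hf₂0 : ∀ s ∈ I 0, f₂ s ≠ 0) (hf₃0 : ∀ s ∈ I 0, ∀ t ∈ I 1, f₃ s t ≠ 0) :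
    IsPolarPair (Set.univ.pi I) (fun x => 1 / f₂ (x 0)) (fun x => 1 / f₃ (x 0) (x 1)) ↔
      Family5 (I 0) (I 1) f₂ f₃ ∨ Family6 (I 0) (I 1) f₂ f₃ ∨ Family7 (I 0) (I 1) f₂ f₃ := by
  have hbox : ∀ a c R δ γ : ℝ, (∀ x ∈ Set.univ.pi I, 1 / f₂ (x 0) = a * (x 0 - c) ∧
      1 / f₃ (x 0) (x 1) = (x 0 - c) * (R * Real.cos (a * x 1 - δ)) + γ) ↔
      ∀ s ∈ I 0, ∀ t ∈ I 1, 1 / f₂ s = a * (s - c) ∧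
        1 / f₃ s t = (s - c) * (R * Real.cos (a * t - δ)) + γ := fun a c R δ γ =>
    forall_mem_box_iff hne (p := fun s t => 1 / f₂ s = a * (s - c) ∧
      1 / f₃ s t = (s - c) * (R * Real.cos (a * t - δ)) + γ)
  simp only [IsPolarPair, hbox]
  obtain ⟨s₀, hs₀⟩ := hne 0
  obtain ⟨t₀, ht₀⟩ := hne 1
  constructor
  · rintro ⟨a, c, R, δ, γ, ha, h⟩
    have h2 : ∀ s ∈ I 0, f₂ s = 1 / a / (s - c) := fun s hs => by
      rw [div_div, ← (h s hs t₀ ht₀).1, one_div_one_div]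
    have h3 : ∀ s ∈ I 0, ∀ t ∈ I 1,
        f₃ s t = 1 / ((s - c) * (R * Real.cos (a * t - δ)) + γ) := fun s hs t ht => by
      rw [← (h s hs t ht).2, one_div_one_div]
    have hc : c ∉ I 0 := fun hc => hf₂0 c hc (by rw [h2 c hc, sub_self, div_zero])
    have ha' : 1 / a ≠ 0 := one_div_ne_zero ha
    have hta : ∀ t, t / (1 / a) = a * t := fun t => by field_simp
    have hq : ∀ s ∈ I 0, ∀ t ∈ I 1, (s - c) * (R * Real.cos (a * t - δ)) + γ ≠ 0 :=
      fun s hs t ht h0 => hf₃0 s hs t ht (by rw [h3 s hs t ht, h0, div_zero])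
    -- `R = 0` gives family 5, `γ = 0` with `R ≠ 0` gives family 6, and both nonzero give family 7;
    -- throughout, `k₂ = 1 / a`.
    by_cases hR : R = 0
    · subst hR
      refine Or.inl ⟨1 / a, 1 / γ, c, ha', ?_, hc, h2, fun s hs t ht => ?_⟩
      · simpa using hq s₀ hs₀ t₀ ht₀
      · simpa using h3 s hs t ht
    by_cases hγ : γ = 0
    · subst hγ
      obtain ⟨n, hn⟩ := sub_mul_pi_abs_lt_of_cos_ne_zero (hconn 1) (a := a) (δ := δ)
        fun t ht h0 => hq s₀ hs₀ t ht (by rw [h0, mul_zero, mul_zero, add_zero])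
      have hε : ((-1 : ℝ) ^ n) ≠ 0 := zpow_ne_zero _ (by norm_num)
      -- Shifting the phase by `n * π` multiplies the cosine by `(-1) ^ n`, which `k₃` absorbs.
      refine Or.inr (Or.inl ⟨1 / a, (-1) ^ n / R, c, δ + n * Real.pi, ha', div_ne_zero hε hR, hc,
        fun t ht => ?_, h2, fun s hs t ht => ?_⟩)
      · rw [hta, ← sub_sub]
        exact hn t ht
      · rw [h3 s hs t ht, hta, ← sub_sub, Real.cos_sub_int_mul_pi, add_zero]
        generalize (-1 : ℝ) ^ n = ε at hε
        field_simp
    · have e : ∀ s t, (s - c) * (R * Real.cos (a * t - δ)) + γ =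
          γ * (1 + R / γ * (s - c) * Real.cos (t / (1 / a) - δ)) := fun s t => by
        rw [hta]; field_simp; ring
      refine Or.inr (Or.inr ⟨1 / a, 1 / γ, R / γ, c, δ, ha', one_div_ne_zero hγ,
        div_ne_zero hR hγ, hc, fun s hs t ht h0 => hq s hs t ht ?_, h2, fun s hs t ht => ?_⟩)
      · rw [e, h0, mul_zero]
      · rw [h3 s hs t ht, e, div_div]
  · have hp : ∀ k₂ c₂ : ℝ, ∀ s, f₂ s = k₂ / (s - c₂) → 1 / f₂ s = 1 / k₂ * (s - c₂) :=
      fun k₂ c₂ s h => by rw [h, one_div_div]; ring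
    have hk : ∀ k₂ t : ℝ, t / k₂ = 1 / k₂ * t := fun k₂ t => by ring
    rintro (⟨k₂, k₃, c₂, hk₂, -, -, h2, h3⟩ | ⟨k₂, k₃, c₂, c₃, hk₂, -, -, -, h2, h3⟩ |
      ⟨k₂, k₃, c₁, c₂, c₃, hk₂, -, -, -, -, h2, h3⟩)
    · exact ⟨1 / k₂, c₂, 0, 0, 1 / k₃, one_div_ne_zero hk₂, fun s hs t ht =>
        ⟨hp _ _ _ (h2 s hs), by rw [h3 s hs t ht]; ring⟩⟩
    · exact ⟨1 / k₂, c₂, 1 / k₃, c₃, 0, one_div_ne_zero hk₂, fun s hs t ht =>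
        ⟨hp _ _ _ (h2 s hs), by rw [h3 s hs t ht, one_div_div, hk k₂ t]; ring⟩⟩
    · exact ⟨1 / k₂, c₂, c₁ / k₃, c₃, 1 / k₃, one_div_ne_zero hk₂, fun s hs t ht =>
        ⟨hp _ _ _ (h2 s hs), by rw [h3 s hs t ht, one_div_div, hk k₂ t]; ring⟩⟩

end Families

/-! ### Direct and warped products -/

theorem projPullback_diagonal {ι : Type*} [DecidableEq ι] (S : Finset ι)
    (d : (S → ℝ) → S → ℝ) (x : ι → ℝ) :
    projPullback S (fun y => Matrix.diagonal (d y)) x =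
      Matrix.diagonal fun i => if h : i ∈ S then d (S.restrict x) ⟨i, h⟩ else 0 := by
  ext i j
  simp only [projPullback, Matrix.mul_apply, Matrix.transpose_apply,
    Matrix.of_apply, Matrix.diagonal_apply, ite_mul, mul_ite, one_mul, zero_mul, mul_one, mul_zero]
  by_cases hj : j ∈ S
  · rw [Finset.sum_eq_single ⟨j, hj⟩]
    · by_cases hij : i = j
      · subst hij
        simp [hj]
      · simp [hij, Ne.symm hij]
    · intro b _ hb
      rw [if_neg fun h => hb (Subtype.ext h)]
    · simp
  · rw [Finset.sum_eq_zero]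
    · by_cases hij : i = j
      · subst hij
        simp [hj]
      · simp [hij]
    · intro b _
      rw [if_neg]
      rintro rfl
      exact hj b.2

theorem isRiemannianMetricOn_diagonal {ι : Type*} [Fintype ι] [DecidableEq ι] {U : Set (ι → ℝ)}
    {d : (ι → ℝ) → ι → ℝ} (hd : ∀ i, ContDiffOn ℝ ∞ (fun x => d x i) U)
    (hpos : ∀ x ∈ U, ∀ i, 0 < d x i) :
    IsRiemannianMetricOn U fun x => Matrix.diagonal (d x) := by
  refine ⟨fun i j => ?_, fun x hx => Matrix.PosDef.diagonal (hpos x hx)⟩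
  by_cases h : i = j
  · subst h
    simpa using hd i
  · simpa [h] using contDiffOn_const

theorem isDirectProductOn_of_eq_diagonal {ι : Type*} [Fintype ι] [DecidableEq ι]
    {I : ι → Set ℝ} {g : (ι → ℝ) → Matrix ι ι ℝ} {d : ι → ℝ} (hd : ∀ i, 0 < d i)
    (hg : ∀ x ∈ Set.univ.pi I, g x = Matrix.diagonal d) : IsDirectProductOn I g := by
  refine ⟨fun i _ => Matrix.diagonal fun _ => d i, fun i =>
    isRiemannianMetricOn_diagonal (fun _ => contDiffOn_const) fun _ _ _ => hd i, fun x hx => ?_⟩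
  rw [hg x hx]
  simp_rw [projPullback_diagonal]
  ext i j
  by_cases h : i = j
  · subst h
    simp [Matrix.sum_apply]
  · simp [Matrix.sum_apply, h]

/-- The outer warping of the sequential product already has the required form: base the first two
factors, fibre the third, warping function `ψ`. -/
theorem isWarpedProductOn_seqWarpedMetric {I : Fin 3 → Set ℝ} {φ : ℝ → ℝ} {ψ : ℝ → ℝ → ℝ}
    (hφ : ContDiffOn ℝ ∞ φ (I 0)) (hφ0 : ∀ s ∈ I 0, φ s ≠ 0)
    (hψ : ContDiffOn ℝ ∞ (fun p : ℝ × ℝ => ψ p.1 p.2) (I 0 ×ˢ I 1))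
    (hψ0 : ∀ s ∈ I 0, ∀ t ∈ I 1, ψ s t ≠ 0) :
    IsWarpedProductOn I (seqWarpedMetric φ ψ) := by
  have m0 : (0 : Fin 3) ∈ ({0, 1} : Finset (Fin 3)) := by decide
  have m1 : (1 : Fin 3) ∈ ({0, 1} : Finset (Fin 3)) := by decide
  have b0 : ∀ y ∈ boxOver I {0, 1}, y ⟨0, m0⟩ ∈ I 0 := fun y hy => hy ⟨0, m0⟩ trivial
  have b1 : ∀ y ∈ boxOver I {0, 1}, y ⟨1, m1⟩ ∈ I 1 := fun y hy => hy ⟨1, m1⟩ trivial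
  refine ⟨{0, 1}, ⟨0, m0⟩, ⟨2, by decide⟩,
    -- The last entry is a filler, as the index 2 lies outside `{0, 1}`.
    fun y => Matrix.diagonal fun i => ![1, φ (y ⟨0, m0⟩) ^ 2, 1] i,
    fun _ => Matrix.diagonal fun _ => 1, fun y => ψ (y ⟨0, m0⟩) (y ⟨1, m1⟩),
    isRiemannianMetricOn_diagonal ?_ ?_,
    isRiemannianMetricOn_diagonal (fun _ => contDiffOn_const) fun _ _ _ => one_pos, ?_,
    fun y hy => hψ0 _ (b0 y hy) _ (b1 y hy), fun x _ => ?_⟩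
  · rintro ⟨i, -⟩
    have h : ContDiffOn ℝ ∞ (fun y : ({0, 1} : Finset (Fin 3)) → ℝ => φ (y ⟨0, m0⟩) ^ 2)
        (boxOver I {0, 1}) := (hφ.comp (contDiff_apply ℝ ℝ _).contDiffOn b0).pow 2
    fin_cases i
    exacts [contDiffOn_const, h, contDiffOn_const]
  · rintro y hy ⟨i, -⟩
    have h := hφ0 _ (b0 y hy)
    fin_cases i
    exacts [one_pos, sq_pos_of_ne_zero h, one_pos]
  · exact hψ.comp ((contDiff_apply ℝ ℝ _).prodMk (contDiff_apply ℝ ℝ _)).contDiffOn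
      fun y hy => ⟨b0 y hy, b1 y hy⟩
  · rw [projPullback_diagonal, projPullback_diagonal, seqWarpedMetric]
    ext i j
    fin_cases i <;> fin_cases j <;> simp

theorem theorem3p8 (I : Fin 3 → Set ℝ)
    (hne : ∀ i, (I i).Nonempty) (hopen : ∀ i, IsOpen (I i)) (hconn : ∀ i, (I i).OrdConnected)
    (f₂ : ℝ → ℝ) (f₃ : ℝ → ℝ → ℝ)
    (hf₂ : ContDiffOn ℝ ∞ f₂ (I 0)) (hf₂0 : ∀ s ∈ I 0, f₂ s ≠ 0)
    (hf₃ : ContDiffOn ℝ ∞ (fun p : ℝ × ℝ => f₃ p.1 p.2) (I 0 ×ˢ I 1))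
    (hf₃0 : ∀ s ∈ I 0, ∀ t ∈ I 1, f₃ s t ≠ 0)
    (g : (Fin 3 → ℝ) → Matrix (Fin 3) (Fin 3) ℝ)
    (hg : g = seqWarpedMetric (fun s => 1 / f₂ s) (fun s t => 1 / f₃ s t)) :
    (IsFlatOn (Set.univ.pi I) g ↔
      Family1 (I 0) (I 1) f₂ f₃ ∨ Family2 (I 0) (I 1) f₂ f₃ ∨ Family3 (I 0) (I 1) f₂ f₃ ∨
      Family4 (I 0) (I 1) f₂ f₃ ∨ Family5 (I 0) (I 1) f₂ f₃ ∨ Family6 (I 0) (I 1) f₂ f₃ ∨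
      Family7 (I 0) (I 1) f₂ f₃) ∧
    (Family1 (I 0) (I 1) f₂ f₃ → IsDirectProductOn I g) ∧
    (Family2 (I 0) (I 1) f₂ f₃ ∨ Family3 (I 0) (I 1) f₂ f₃ ∨ Family4 (I 0) (I 1) f₂ f₃ ∨
      Family5 (I 0) (I 1) f₂ f₃ → IsWarpedProductOn I g) := by
  have hφ : ContDiffOn ℝ ∞ (fun s => 1 / f₂ s) (I 0) := contDiffOn_const.div hf₂ hf₂0
  have hψ : ContDiffOn ℝ ∞ (fun p : ℝ × ℝ => 1 / f₃ p.1 p.2) (I 0 ×ˢ I 1) :=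
    contDiffOn_const.div hf₃ fun p hp => hf₃0 _ hp.1 _ hp.2
  have hφ0 : ∀ s ∈ I 0, 1 / f₂ s ≠ 0 := fun s hs => one_div_ne_zero (hf₂0 s hs)
  have hψ0 : ∀ s ∈ I 0, ∀ t ∈ I 1, 1 / f₃ s t ≠ 0 := fun s hs t ht =>
    one_div_ne_zero (hf₃0 s hs t ht)
  refine ⟨?_, ?_, fun _ => hg ▸ isWarpedProductOn_seqWarpedMetric hφ hφ0 hψ hψ0⟩
  · set U := Set.univ.pi I with hU_def
    have hU : IsOpen U := isOpen_set_pi Set.finite_univ fun i _ => hopen i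
    have hUc : IsPreconnected U := (convex_pi fun i _ => (hconn i).convex).isPreconnected
    have hUne : U.Nonempty := Set.univ_pi_nonempty_iff.2 hne
    have b0 : ∀ x ∈ U, x 0 ∈ I 0 := fun x hx => hx 0 trivial
    have b1 : ∀ x ∈ U, x 1 ∈ I 1 := fun x hx => hx 1 trivial
    have hP0 : ∀ x ∈ U, 1 / f₂ (x 0) ≠ 0 := fun x hx => hφ0 _ (b0 x hx)
    have hQ0 : ∀ x ∈ U, 1 / f₃ (x 0) (x 1) ≠ 0 := fun x hx => hψ0 _ (b0 x hx) _ (b1 x hx)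
    have hgU : ∀ x ∈ U,
        g x = Matrix.diagonal ![1, (1 / f₂ (x 0)) ^ 2, (1 / f₃ (x 0) (x 1)) ^ 2] :=
      fun x _ => by rw [hg, seqWarpedMetric]
    have hJ := HasSeqWarpedJet.of_contDiffOn (P := fun x => 1 / f₂ (x 0))
      (Q := fun x => 1 / f₃ (x 0) (x 1)) hU
      (hφ.comp (contDiff_apply ℝ ℝ _).contDiffOn b0)
      (hψ.comp ((contDiff_apply ℝ ℝ _).prodMk (contDiff_apply ℝ ℝ _)).contDiffOn
        fun x hx => ⟨b0 x hx, b1 x hx⟩)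
      hP0 hQ0 (fun x r => by simp) (fun x r => by simp) (fun x r => by simp)
    have hflat : IsFlatOn U g ↔
        IsAffinePair U (fun x => 1 / f₂ (x 0)) (fun x => 1 / f₃ (x 0) (x 1)) ∨
        IsPolarPair U (fun x => 1 / f₂ (x 0)) (fun x => 1 / f₃ (x 0) (x 1)) :=
      ⟨fun h => hJ.isAffinePair_or_isPolarPair hU hUc hUne ((hJ.isFlatOn_iff hU hgU).1 h),
        fun h => h.elim (fun h => h.isFlatOn hU hgU hP0 hQ0) fun h => h.isFlatOn hU hgU hP0 hQ0⟩
    rw [hflat, isAffinePair_iff hne hf₂0 hf₃0, isPolarPair_iff hne hconn hf₂0 hf₃0]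
    simp only [or_assoc]
  · rintro ⟨k₂, k₃, hk₂, hk₃, h2, h3⟩
    refine isDirectProductOn_of_eq_diagonal (d := ![1, (1 / k₂) ^ 2, (1 / k₃) ^ 2])
      (fun i => ?_) fun x hx => ?_
    · fin_cases i <;> simp <;> positivity
    · rw [hg, seqWarpedMetric, h2 _ (hx 0 trivial), h3 _ (hx 0 trivial) _ (hx 1 trivial)]
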